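/- Let $r,d,m,D\ge 1$ be integers. An $r$-uniform hypergraph $H$ on $N$ vertices is semi-algebraic of complexity $(d,D,m)$ if there are an enumeration $v_1,\dots,v_N$ of its vertices, points $p_1,\dots,p_N\in\mathbb{R}^d$, real polynomials $f_1,\dots,f_m$ on $(\mathbb{R}^d)^r$ of total degree at most $D$, and a function $\Phi:\{+,-,0\}^m\to\{\text{True},\text{False}\}$ such that for all $1\le i_1<\dots<i_r\le N$, the set $\{v_{i_1},\dots,v_{i_r}\}$ is an edge of $H$ if and only if $$\Phi\big(\operatorname{sign} f_1(p_{i_1},\dots,p_{i_r}),\dots,\operatorname{sign} f_m(p_{i_1},\dots,p_{i_r})\big)=\text{True}.$$ It is semi-linear of complexity $(d,m)$ if this holds with $D=1$. Let $R_r^{d,D,m}(n)$ be the smallest $N$ such that every $r$-uniform semi-algebraic hypergraph of complexity $(d,D,m)$ on $N$ vertices contains a clique of size $n$ (a set of $n$ vertices all of whose $r$-element subsets are edges) or an independent set of size $n$ (a set of $n$ vertices none of whose $r$-element subsets is an edge). **Theorem.** For all positive integers $r,m$ there is a constant $c=c(r,m)>0$ such that for all positive integers $d,n$ the number $R_r^{d,1,m}(n)$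 exists and $$R_r^{d,1,m}(n)\le 2^{c\,n^{4r^2m^2}}.$$ Consequently, for all positive integers $r,m$ there is $\delta=\delta(r,m)>0$ such that for all $d\ge 1$ and $N\ge 0$, every $r$-uniform semi-linear hypergraph of complexity $(d,m)$ on $N$ vertices has a clique or an independent set of size at least $(\log N)^{\delta}$, where $\log$ is the natural logarithm and $\log 0$ is read as $0$. -/

import Mathlib

open scoped Hypergraph

namespace Hypergraph

/-- Every edge of `H` has exactly `r` vertices. -/
def IsUniform {α : Type*} (H : Hypergraph α) (r : ℕ) : Prop :=
  ∀ e ∈ E(H), e.encard = r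

/-- `S` is a clique of the `r`-uniform hypergraph `H`: a set of vertices all of whose
`r`-element subsets are edges. -/
def IsClique {α : Type*} (H : Hypergraph α) (r : ℕ) (S : Set α) : Prop :=
  S ⊆ V(H) ∧ ∀ e : Set α, e ⊆ S → e.encard = r → e ∈ E(H)

/-- `S` is an independent set of the `r`-uniform hypergraph `H`: a set of vertices none of whose
`r`-element subsets is an edge. -/
def IsIndependent {α : Type*} (H : Hypergraph α) (r : ℕ) (S : Set α) : Prop :=
  S ⊆ V(H) ∧ ∀ e : Set α, e ⊆ S → e.encard = r → e ∉ E(H)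

/-- `H` is an `r`-uniform semi-algebraic hypergraph of complexity `(d, D, m)`: there are an
enumeration `v` of its (finitely many) vertices, points `p` of `ℝ ^ d` assigned to them,
`m` real polynomials `f` of total degree at most `D` on `(ℝ ^ d) ^ r` (the variable `(a, b)` is
the `b`-th coordinate of the `a`-th point) and a Boolean function `Φ` of sign patterns such that,
for indices `i 0 < i 1 < ... `, the set `{v (i 0), v (i 1), ...}` is an edge if and only if `Φ` is
true on the signs of the values of `f` at `(p (i 0), p (i 1), ...)`. -/
def IsSemialgebraic {α : Type*} (H : Hypergraph α) (r d D m : ℕ) : Prop :=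
  H.IsUniform r ∧
  ∃ (N : ℕ) (v : Fin N → α) (p : Fin N → Fin d → ℝ)
    (f : Fin m → MvPolynomial (Fin r × Fin d) ℝ) (Φ : (Fin m → SignType) → Prop),
    Function.Injective v ∧ Set.range v = V(H) ∧
    (∀ j, (f j).totalDegree ≤ D) ∧
    ∀ i : Fin r → Fin N, StrictMono i →
      (Set.range (v ∘ i) ∈ E(H) ↔
        Φ fun j => SignType.sign (MvPolynomial.eval (fun x => p (i x.1) x.2) (f j)))

/-- `H` is an `r`-uniform semi-linear hypergraph of complexity `(d, m)`. -/
def IsSemilinear {α : Type*} (H : Hypergraph α) (r d m : ℕ) : Prop :=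
  H.IsSemialgebraic r d 1 m

end Hypergraph

/-- Every `r`-uniform semi-algebraic hypergraph of complexity `(d, D, m)` on `N` vertices contains
a clique of size `s` or an independent set of size `n`. -/
def SemialgebraicRamseyProperty (r d D m s n N : ℕ) : Prop :=
  ∀ (α : Type) (H : Hypergraph α), H.IsSemialgebraic r d D m → V(H).encard = N →
    (∃ S : Set α, H.IsClique r S ∧ S.encard = s) ∨
      (∃ S : Set α, H.IsIndependent r S ∧ S.encard = n)

/-- The semi-algebraic Ramsey number `R_r^{d,D,m}(s, n)`: the smallest `N` with the property above
(and `0` if there were no such `N`). -/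
noncomputable def semialgebraicRamsey (r d D m s n : ℕ) : ℕ :=
  sInf {N : ℕ | SemialgebraicRamseyProperty r d D m s n N}

/-! An affine form on an increasing tuple is a constant plus one term for each position, so the
dimension disappears and only q = m * r real sequences on the vertices matter. It suffices to find a
large vertex set on which each of the m forms has a constant sign on increasing tuples: its
r-subsets are then all edges or all non-edges.

The first half makes every sequence lacunary around some centre (`exists_forall_resolved`). Seen
from a fixed centre, a sequence either occupies many geometric scales, and Erdős–Szekeres extracts a
lacunary subsequence, or falls into few clusters that are small compared with their distance from
the centre (`exists_resolved_or_coloring`). If some sequence is resolved on a large subset, it is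
settled and the others are treated inside that subset. Otherwise clusters are available for all of
them and every centre: repeatedly removing the least point and passing to a common cluster makes the
distances to the last point decay geometrically in all sequences at once. Each sequence costs one
more factor n in the exponent.

The second half recentres each form, so that its terms are one constant and r lacunary functions,
and finds, with polynomial loss, a subset where a fixed term dominates all others on every
increasing tuple (`exists_subset_forall_dominates`). The sign of the form is then the sign of that
term, which a pigeonhole has already made constant. Resolving about n ^ (q + 1) points gives the
exponent (q + 1) ^ 2 ≤ 4 * q ^ 2. -/

/-! ### Lacunary sequences and simultaneous resolution -/

/-- On `S` the function `g` grows at least by the factor `K` from each element to each later one. -/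
def LacunaryUp {α : Type*} [LinearOrder α] (K : ℝ) (g : α → ℝ) (S : Finset α) : Prop :=
  ∀ i ∈ S, ∀ k ∈ S, i < k → K * g i ≤ g k

/-- On `S` the function `g` shrinks at least by the factor `K` from each element to each later
one. -/
def LacunaryDown {α : Type*} [LinearOrder α] (K : ℝ) (g : α → ℝ) (S : Finset α) : Prop :=
  ∀ i ∈ S, ∀ k ∈ S, i < k → K * g k ≤ g i

/-- The distances of the values of `x` on `S` from some centre are lacunary. -/
def Resolved {α : Type*} [LinearOrder α] (K : ℝ) (x : α → ℝ) (S : Finset α) : Prop :=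
  ∃ c : ℝ, LacunaryUp K (fun i => |x i - c|) S ∨ LacunaryDown K (fun i => |x i - c|) S

section Lacunary

variable {α : Type*} [LinearOrder α]

theorem LacunaryUp.mono {K : ℝ} {g : α → ℝ} {S T : Finset α} (h : LacunaryUp K g S)
    (hT : T ⊆ S) : LacunaryUp K g T :=
  fun i hi k hk => h i (hT hi) k (hT hk)

theorem LacunaryDown.mono {K : ℝ} {g : α → ℝ} {S T : Finset α} (h : LacunaryDown K g S)
    (hT : T ⊆ S) : LacunaryDown K g T :=
  fun i hi k hk => h i (hT hi) k (hT hk)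

theorem Resolved.mono {K : ℝ} {x : α → ℝ} {S T : Finset α} (h : Resolved K x S)
    (hT : T ⊆ S) : Resolved K x T := by
  obtain ⟨c, h | h⟩ := h
  · exact ⟨c, Or.inl (h.mono hT)⟩
  · exact ⟨c, Or.inr (h.mono hT)⟩

/-- The Erdős–Szekeres theorem for an injective function on a finite set. -/
theorem exists_strictMonoOn_or_strictAntiOn {β : Type*} [LinearOrder β] (f : α → β) (a b : ℕ)
    (W : Finset α) (hf : Set.InjOn f W) (hW : a * b < W.card) :
    (∃ T ⊆ W, a < T.card ∧ StrictMonoOn f T) ∨ (∃ T ⊆ W, b < T.card ∧ StrictAntiOn f T) := by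
  classical
  induction a generalizing W with
  | zero =>
    left
    obtain ⟨w, hw⟩ := Finset.card_pos.1 (by omega : 0 < W.card)
    exact ⟨{w}, by simpa using hw, by simp, by simp⟩
  | succ a ih =>
    -- The left-to-right minima of `W`, on which `f` decreases. If they are few, an increasing set
    -- found among the other points can be prolonged downwards, because its first point is preceded
    -- by a smaller value.
    set A := W.filter (fun i => ∀ j ∈ W, j < i → ¬ f j < f i) with hA
    by_cases hAb : b < A.card
    · right
      refine ⟨A, Finset.filter_subset _ _, hAb, ?_⟩
      intro i hi k hk hik
      simp only [hA, Finset.coe_filter, Set.mem_ofPred_eq] at hi hk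
      refine lt_of_le_of_ne (not_lt.1 (hk.2 i hi.1 hik)) fun h => hik.ne' (hf hk.1 hi.1 h)
    · have hsub : W \ A ⊆ W := Finset.sdiff_subset
      have hcard : a * b < (W \ A).card := by
        have h1 := Finset.le_card_sdiff A W
        have h2 : (a + 1) * b = a * b + b := by ring
        omega
      rcases ih (W \ A) (hf.mono (by exact_mod_cast hsub)) hcard with ⟨T, hT, hTc, hmono⟩ | ⟨T, hT, h⟩
      · left
        have hne : T.Nonempty := Finset.card_pos.1 (by omega)
        have hmin := Finset.min'_mem T hne
        have h1 := hT hmin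
        simp only [hA, Finset.mem_sdiff, Finset.mem_filter, not_and, not_forall, not_not] at h1
        obtain ⟨j, hj, hjlt, hfj⟩ := h1.2 h1.1
        have hjT : ∀ t ∈ T, j < t ∧ f j < f t := by
          intro t ht
          have h2 := Finset.min'_le T t ht
          exact ⟨hjlt.trans_le h2, hfj.trans_le (hmono.monotoneOn hmin ht h2)⟩
        have hjn : j ∉ T := fun h => lt_irrefl _ (hjT j h).1
        refine ⟨insert j T, Finset.insert_subset hj (hT.trans hsub), ?_, ?_⟩
        · rw [Finset.card_insert_of_notMem hjn]; omega
        · intro s hs t ht hst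
          simp only [Finset.coe_insert, Set.mem_insert_iff, Finset.mem_coe] at hs ht
          rcases hs with rfl | hs <;> rcases ht with rfl | ht
          · exact absurd hst (lt_irrefl _)
          · exact (hjT t ht).2
          · exact absurd hst (hjT s hs).1.not_gt
          · exact hmono hs ht hst
      · right
        exact ⟨T, hT.trans hsub, h⟩

/-- A function with at most `B` values on `W` factors through `Fin B` there. -/
theorem exists_fin_coloring {α γ : Type*} [DecidableEq γ] (f : α → γ) (W : Finset α) (B : ℕ)
    (hB : 0 < B) (h : (W.image f).card ≤ B) :
    ∃ κ : α → Fin B, ∀ w ∈ W, ∀ w' ∈ W, κ w = κ w' → f w = f w' := by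
  classical
  let e := (W.image f).equivFin
  refine ⟨fun w => if hw : f w ∈ W.image f then Fin.castLE h (e ⟨f w, hw⟩) else ⟨0, hB⟩, ?_⟩
  intro w hw w' hw' heq
  have h1 := Finset.mem_image_of_mem f hw
  have h2 := Finset.mem_image_of_mem f hw'
  simp only [h1, h2, dif_pos] at heq
  have := e.injective (Fin.castLE_injective h heq)
  simpa using this

/-- Two numbers in the same cell of the partition of the line into geometric scales of ratio
`1 + 1 / K` are close to each other in comparison with their size. -/
theorem mul_abs_sub_le_of_scale {K y z : ℝ} (hK : 1 ≤ K) {s : ℤ}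
    (hsign : SignType.sign y = SignType.sign z)
    (hy : |y| ∈ Set.Ico ((1 + 1 / K) ^ s) ((1 + 1 / K) ^ (s + 1)))
    (hz : |z| ∈ Set.Ico ((1 + 1 / K) ^ s) ((1 + 1 / K) ^ (s + 1))) :
    K * |y - z| ≤ |y| := by
  have hK0 : 0 < K := by linarith
  have hθ : (0 : ℝ) < 1 + 1 / K := by positivity
  rw [zpow_add₀ hθ.ne', zpow_one] at hy hz
  set b := (1 + 1 / K) ^ s
  have hb : 0 < b := zpow_pos hθ s
  have hsplit : b * (1 + 1 / K) = b + b / K := by ring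
  rw [hsplit] at hy hz
  have habs : |y - z| = |(|y| - |z|)| := by
    have e1 := sign_mul_abs y
    have e2 := sign_mul_abs z
    rcases lt_trichotomy y 0 with h | h | h
    · have hz' : z < 0 := by rw [sign_neg h] at hsign; exact sign_eq_neg_one_iff.1 hsign.symm
      rw [abs_of_neg h, abs_of_neg hz', ← abs_neg]; congr 1; ring
    · have hz' : z = 0 := by rw [h, sign_zero] at hsign; exact sign_eq_zero_iff.1 hsign.symm
      simp [h, hz']
    · have hz' : 0 < z := by rw [sign_pos h] at hsign; exact sign_eq_one_iff.1 hsign.symm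
      rw [abs_of_pos h, abs_of_pos hz']
  have hle : |y - z| ≤ b / K := by
    rw [habs, abs_le]
    constructor <;> linarith [hy.1, hy.2, hz.1, hz.2]
  calc K * |y - z| ≤ K * (b / K) := by gcongr
    _ = b := by field_simp
    _ ≤ |y| := hy.1

/-- Either `x` is resolved on a large subset of `W`, or its values on `W`, seen from a given
centre, fall into few clusters. -/
theorem exists_resolved_or_coloring {K : ℝ} (hK : 1 ≤ K) {p : ℕ} (hp : K ≤ (1 + 1 / K) ^ p)
    (x : α → ℝ) (c : ℝ) (W : Finset α) {M : ℕ} (hM : 1 ≤ M) :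
    (∃ T ⊆ W, M ≤ T.card ∧ Resolved K x T) ∨
      ∃ κ : α → Fin (2 ^ (p + 3) * M ^ 2), ∀ w ∈ W, ∀ w' ∈ W, κ w = κ w' →
        K * |x w - x w'| ≤ |x w - c| := by
  classical
  have hK0 : 0 < K := by linarith
  have hθ : (1 : ℝ) < 1 + 1 / K := by simpa using hK0
  -- A point at the centre has no scale; the default 0 is harmless because the sign recorded with
  -- the scale tells it apart.
  have hex : ∀ w, ∃ s : ℤ, (x w = c → s = 0) ∧
      (x w ≠ c → |x w - c| ∈ Set.Ico ((1 + 1 / K) ^ s) ((1 + 1 / K) ^ (s + 1))) := by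
    intro w
    by_cases hw : x w = c
    · exact ⟨0, fun _ => rfl, fun h => absurd hw h⟩
    · obtain ⟨s, hs⟩ := exists_mem_Ico_zpow (abs_pos.2 (sub_ne_zero.2 hw)) hθ
      exact ⟨s, fun h => absurd h hw, fun _ => hs⟩
  choose s hs0 hs using hex
  set W0 := W.filter (fun w => x w ≠ c) with hW0
  set A := W0.image s with hA
  -- Distinct scales in one residue class differ by at least `p + 1`. One step is lost to the width
  -- of the scale, and the remaining `p` steps give the factor `K`.
  have hsep : ∀ w ∈ W0, ∀ w' ∈ W0, ((s w : ℤ) : ZMod (p + 1)) = ((s w' : ℤ) : ZMod (p + 1)) →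
      s w < s w' → K * |x w - c| ≤ |x w' - c| := by
    intro w hw w' hw' hmod hlt
    have h1 := hs w (Finset.mem_filter.1 hw).2
    have h2 := hs w' (Finset.mem_filter.1 hw').2
    rw [ZMod.intCast_eq_intCast_iff_dvd_sub] at hmod
    have h3 : ((p + 1 : ℕ) : ℤ) ≤ s w' - s w := Int.le_of_dvd (by omega) hmod
    calc K * |x w - c| ≤ (1 + 1 / K) ^ p * (1 + 1 / K) ^ (s w + 1) := by
          gcongr; exact h1.2.le
      _ = (1 + 1 / K) ^ ((p : ℤ) + (s w + 1)) := by
          rw [zpow_add₀ (by positivity) (p : ℤ), zpow_natCast]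
      _ ≤ (1 + 1 / K) ^ (s w') := by
          apply zpow_le_zpow_right₀ hθ.le; push_cast at h3; omega
      _ ≤ _ := h2.1
  by_cases hcard : (p + 1) * M ^ 2 < A.card
  · left
    have hpig := Finset.exists_lt_card_fiber_of_mul_lt_card_of_maps_to
      (s := A) (t := (Finset.univ : Finset (ZMod (p + 1)))) (f := fun a : ℤ => (a : ZMod (p + 1)))
      (n := M ^ 2) (fun _ _ => Finset.mem_univ _) (by simpa [ZMod.card] using hcard)
    obtain ⟨y, -, hy⟩ := hpig
    set A' := A.filter (fun a : ℤ => (a : ZMod (p + 1)) = y) with hA'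
    -- One representative for each scale, so that Erdős–Szekeres applies to `s`.
    obtain ⟨T0, hT0, hT0inj, hT0im⟩ : ∃ T0 ⊆ W0, Set.InjOn s T0 ∧ T0.image s = A' := by
      have : ((A' : Set ℤ)) ⊆ s '' (W0 : Set α) := by
        intro a ha
        have := (Finset.mem_filter.1 (Finset.mem_coe.1 ha)).1
        simpa [hA] using this
      obtain ⟨T0, h1, h2, h3⟩ := Finset.exists_subset_injOn_image_eq_of_surjOn
        (W0 : Set α) A' this
      exact ⟨T0, by exact_mod_cast h1, h2, h3⟩
    have hT0c : M * M < T0.card := by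
      rw [← Finset.card_image_of_injOn hT0inj, hT0im, ← pow_two]; exact hy
    have hres : ∀ w ∈ T0, ((s w : ℤ) : ZMod (p + 1)) = y := by
      intro w hw
      have : s w ∈ A' := hT0im ▸ Finset.mem_image_of_mem s hw
      exact (Finset.mem_filter.1 this).2
    have hT0W : T0 ⊆ W := hT0.trans (Finset.filter_subset _ _)
    rcases exists_strictMonoOn_or_strictAntiOn s M M T0 hT0inj hT0c with
      ⟨T, hT, hTc, hm⟩ | ⟨T, hT, hTc, hm⟩
    · refine ⟨T, hT.trans hT0W, hTc.le, c, Or.inl ?_⟩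
      intro i hi k hk hik
      exact hsep i (hT0 (hT hi)) k (hT0 (hT hk)) (by rw [hres i (hT hi), hres k (hT hk)])
        (hm hi hk hik)
    · refine ⟨T, hT.trans hT0W, hTc.le, c, Or.inr ?_⟩
      intro i hi k hk hik
      exact hsep k (hT0 (hT hk)) i (hT0 (hT hi)) (by rw [hres i (hT hi), hres k (hT hk)])
        (hm hi hk hik)
  · right
    -- Three signs and at most `(p + 1) * M ^ 2 + 1` scales, counting the default one.
    have hle : (W.image fun w => (SignType.sign (x w - c), s w)).card ≤ 2 ^ (p + 3) * M ^ 2 := by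
      have hsub : (W.image fun w => (SignType.sign (x w - c), s w)) ⊆
          (Finset.univ : Finset SignType) ×ˢ (insert 0 A) := by
        intro z hz
        obtain ⟨w, hw, rfl⟩ := Finset.mem_image.1 hz
        simp only [Finset.mem_product, Finset.mem_univ, true_and, Finset.mem_insert]
        by_cases h : x w = c
        · exact Or.inl (hs0 w h)
        · exact Or.inr (Finset.mem_image_of_mem _ (Finset.mem_filter.2 ⟨hw, h⟩))
      have h1 := Finset.card_le_card hsub
      rw [Finset.card_product] at h1
      have h2 := Finset.card_insert_le (0 : ℤ) A
      have h3 : (Finset.univ : Finset SignType).card = 3 := rfl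
      rw [h3] at h1
      have h4 : p + 2 ≤ 2 ^ (p + 1) := (Nat.lt_two_pow_self (n := p + 1))
      have h5 : 1 ≤ M ^ 2 := Nat.one_le_pow _ _ hM
      have h6 : (2 : ℕ) ^ (p + 3) = 4 * 2 ^ (p + 1) := by ring
      rw [h6]
      nlinarith
    obtain ⟨κ, hκ⟩ := exists_fin_coloring _ W _ (by positivity) hle
    refine ⟨κ, fun w hw w' hw' h => ?_⟩
    have h1 := hκ w hw w' hw' h
    simp only [Prod.mk.injEq] at h1
    by_cases hwc : x w = c
    · have h2 : x w' = c := by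
        have := h1.1
        rw [hwc, sub_self, sign_zero] at this
        exact sub_eq_zero.1 (sign_eq_zero_iff.1 this.symm)
      simp [hwc, h2]
    · have hwc' : x w' ≠ c := by
        intro h2
        have := h1.1
        rw [h2, sub_self, sign_zero] at this
        exact hwc (sub_eq_zero.1 (sign_eq_zero_iff.1 this))
      have h3 := mul_abs_sub_le_of_scale hK h1.1 (hs w hwc) (h1.2 ▸ hs w' hwc')
      simpa using h3

/-- If all coordinates in `I`, seen from any element of `W`, fall into at most `B` clusters, then
repeatedly taking the least element and passing to a cluster resolves all of them. -/
theorem exists_lacunaryDown_of_coloring {ι : Type*} [Fintype ι] {K : ℝ} (x : ι → α → ℝ)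
    (I : Finset ι) (W : Finset α) {B : ℕ} (hB : 0 < B)
    (h : ∀ a ∈ I, ∀ l ∈ W, ∃ κ : α → Fin B, ∀ w ∈ W, ∀ w' ∈ W, κ w = κ w' →
      K * |x a w - x a w'| ≤ |x a w - x a l|)
    (n : ℕ) (V : Finset α) (hV : V ⊆ W) (hn : (2 * B ^ Fintype.card ι) ^ n ≤ V.card) :
    ∃ T ⊆ V, T.card = n + 1 ∧ ∃ e ∈ T, ∀ a ∈ I, LacunaryDown K (fun i => |x a i - x a e|) T := by
  classical
  induction n generalizing V with
  | zero =>
    obtain ⟨e, he⟩ := Finset.card_pos.1 (by simpa using hn : 0 < V.card)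
    refine ⟨{e}, by simpa using he, by simp, e, by simp, fun a _ i hi k hk hik => ?_⟩
    simp only [Finset.mem_singleton] at hi hk
    exact absurd hik (by simp [hi, hk])
  | succ n ih =>
    set Q := B ^ Fintype.card ι with hQ
    have hQ0 : 0 < Q := by positivity
    have hVpos : 0 < V.card := lt_of_lt_of_le (by positivity) hn
    have hne : V.Nonempty := Finset.card_pos.1 hVpos
    set l := V.min' hne
    have hl : l ∈ V := Finset.min'_mem _ _
    have hcol : ∀ a, ∃ κ : α → Fin B, a ∈ I → ∀ w ∈ W, ∀ w' ∈ W, κ w = κ w' →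
        K * |x a w - x a w'| ≤ |x a w - x a l| := by
      intro a
      by_cases ha : a ∈ I
      · obtain ⟨κ, hκ⟩ := h a ha l (hV hl)
        exact ⟨κ, fun _ => hκ⟩
      · exact ⟨fun _ => ⟨0, hB⟩, fun h => absurd h ha⟩
    choose κ hκ using hcol
    -- The factor 2 in the size pays for the removal of `l`.
    have hmul : Q * (2 * Q) ^ n ≤ (V.erase l).card := by
      rw [Finset.card_erase_of_mem hl]
      have h1 : (2 * Q) ^ (n + 1) = Q * (2 * Q) ^ n + Q * (2 * Q) ^ n := by ring
      have h2 : 0 < Q * (2 * Q) ^ n := by positivity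
      omega
    obtain ⟨y, -, hy⟩ := Finset.exists_le_card_fiber_of_mul_le_card_of_maps_to
      (s := V.erase l) (t := (Finset.univ : Finset (ι → Fin B))) (f := fun w a => κ a w)
      (n := (2 * Q) ^ n) (fun _ _ => Finset.mem_univ _) ⟨fun _ => ⟨0, hB⟩, Finset.mem_univ _⟩
      (by simpa [hQ] using hmul)
    set V' := (V.erase l).filter (fun w => (fun a => κ a w) = y) with hV'
    have hV'V : V' ⊆ V := (Finset.filter_subset _ _).trans (Finset.erase_subset _ _)
    obtain ⟨T, hT, hTc, e, he, hlac⟩ := ih V' (hV'V.trans hV) hy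
    have hlt : ∀ t ∈ T, l < t := by
      intro t ht
      have h1 := Finset.mem_erase.1 (Finset.mem_filter.1 (hT ht)).1
      exact lt_of_le_of_ne (Finset.min'_le _ _ h1.2) (Ne.symm h1.1)
    have hlT : l ∉ T := fun h => lt_irrefl _ (hlt l h)
    refine ⟨insert l T, Finset.insert_subset hl (hT.trans hV'V), ?_, e,
      Finset.mem_insert_of_mem he, ?_⟩
    · rw [Finset.card_insert_of_notMem hlT, hTc]
    · intro a ha i hi k hk hik
      rcases Finset.mem_insert.1 hi with rfl | hi <;> rcases Finset.mem_insert.1 hk with rfl | hk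
      · exact absurd hik (lt_irrefl _)
      -- Both `e` and `k` lie in one cluster as seen from `l`, so `k` is much closer to `e` than `l`
      -- is.
      · have h1 := (Finset.mem_filter.1 (hT he)).2
        have h2 := (Finset.mem_filter.1 (hT hk)).2
        have h3 := hκ a ha e (hV (hV'V (hT he))) k (hV (hV'V (hT hk)))
          ((congrFun h1 a).trans (congrFun h2 a).symm)
        simp only
        rw [abs_sub_comm (x a k), abs_sub_comm (x a l)]
        exact h3
      · exact absurd hik (hlt i hi).not_gt
      · exact hlac a ha i hi k hk hik

end Lacunary

/-- The constant in the exponent of the number of points needed to resolve `u` coordinates. -/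
def resolveConst (p q : ℕ) : ℕ → ℕ
  | 0 => 1
  | u + 1 => 1 + q * (p + 3 + 2 * resolveConst p q u)

/-- Simultaneous resolution of several real sequences on a subset of polylogarithmic size. -/
theorem exists_forall_resolved {α ι : Type*} [LinearOrder α] [Fintype ι] {K : ℝ} (hK : 1 ≤ K)
    {p : ℕ} (hp : K ≤ (1 + 1 / K) ^ p) (x : ι → α → ℝ) {n : ℕ} (hn : 1 ≤ n) (u : ℕ)
    (I : Finset ι) (hI : I.card = u) (W : Finset α)
    (hW : 2 ^ (resolveConst p (Fintype.card ι) u * n ^ (u + 1)) ≤ W.card) :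
    ∃ S ⊆ W, n ≤ S.card ∧ ∀ a ∈ I, Resolved K (x a) S := by
  classical
  induction u generalizing I W with
  | zero =>
    refine ⟨W, subset_rfl, ?_, ?_⟩
    · simp only [resolveConst, zero_add, pow_one, one_mul] at hW
      exact Nat.lt_two_pow_self.le.trans hW
    · simp [Finset.card_eq_zero.1 hI]
  | succ u ih =>
    set q := Fintype.card ι with hq
    set C := resolveConst p q u with hC
    set M := 2 ^ (C * n ^ (u + 1)) with hM
    -- `M` is the size at which the induction hypothesis settles the remaining `u` coordinates.
    have hM1 : 1 ≤ M := Nat.one_le_two_pow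
    by_cases hbig : ∃ a ∈ I, ∃ T ⊆ W, M ≤ T.card ∧ Resolved K (x a) T
    · obtain ⟨a, ha, T, hT, hTc, hres⟩ := hbig
      obtain ⟨S, hS, hSc, hSr⟩ := ih (I.erase a) (by rw [Finset.card_erase_of_mem ha]; omega) T hTc
      refine ⟨S, hS.trans hT, hSc, fun b hb => ?_⟩
      by_cases hba : b = a
      · exact hba ▸ hres.mono hS
      · exact hSr b (Finset.mem_erase.2 ⟨hba, hb⟩)
    · have hcol : ∀ a ∈ I, ∀ l ∈ W, ∃ κ : α → Fin (2 ^ (p + 3) * M ^ 2), ∀ w ∈ W, ∀ w' ∈ W,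
          κ w = κ w' → K * |x a w - x a w'| ≤ |x a w - x a l| := by
        intro a ha l _
        rcases exists_resolved_or_coloring hK hp (x a) (x a l) W hM1 with ⟨T, hT⟩ | h
        · exact absurd ⟨a, ha, T, hT⟩ hbig
        · exact h
      have hsize : (2 * (2 ^ (p + 3) * M ^ 2) ^ q) ^ n ≤ W.card := by
        refine le_trans ?_ hW
        have h1 : (2 * (2 ^ (p + 3) * M ^ 2) ^ q) ^ n =
            2 ^ ((1 + q * (p + 3 + 2 * (C * n ^ (u + 1)))) * n) := by
          rw [hM, ← pow_mul, ← pow_add, ← pow_mul, ← pow_succ', ← pow_mul]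
          congr 1; ring
        rw [h1]
        apply Nat.pow_le_pow_right (by norm_num)
        have h2 : 1 ≤ n ^ (u + 1) := Nat.one_le_pow _ _ hn
        show _ ≤ (1 + q * (p + 3 + 2 * C)) * n ^ (u + 1 + 1)
        rw [pow_succ n (u + 1), ← mul_assoc _ _ n]
        apply Nat.mul_le_mul_right
        set Y := n ^ (u + 1)
        have h3 : q * (p + 3) ≤ q * (p + 3) * Y := Nat.le_mul_of_pos_right _ h2
        nlinarith
      obtain ⟨T, hT, hTc, e, -, hlac⟩ := exists_lacunaryDown_of_coloring x I W (by positivity) hcol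
        n W subset_rfl hsize
      exact ⟨T, hT, by omega, fun a ha => ⟨x a e, Or.inr (hlac a ha)⟩⟩

/-! ### Dominating terms of a sum -/

section Domination

variable {α : Type*} [LinearOrder α] {r : ℕ}

/-- The sizes of the terms of the sum of a constant of size `L` and of one term `g a (i a)` for
each position `a`; the constant is the term `none`. -/
def termSize (g : Fin r → α → ℝ) (L : ℝ) (i : Fin r → α) : Option (Fin r) → ℝ
  | none => L
  | some a => g a (i a)

/-- On all increasing tuples from `S` the term `t` is at least `K` times as large as `t'`. -/
def Dominates (K : ℝ) (g : Fin r → α → ℝ) (L : ℝ) (S : Finset α) (t t' : Option (Fin r)) : Prop :=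
  ∀ i : Fin r → α, StrictMono i → (∀ a, i a ∈ S) → K * termSize g L i t' ≤ termSize g L i t

theorem Dominates.mono {K : ℝ} {g : Fin r → α → ℝ} {L : ℝ} {S T : Finset α}
    {t t' : Option (Fin r)} (h : Dominates K g L S t t') (hT : T ⊆ S) : Dominates K g L T t t' :=
  fun i hi hmem => h i hi fun a => hT (hmem a)

theorem termSize_nonneg {α : Type*} {g : Fin r → α → ℝ} {L : ℝ} (hg : ∀ a i, 0 ≤ g a i) (hL : 0 ≤ L)
    (i : Fin r → α) (t : Option (Fin r)) : 0 ≤ termSize g L i t := by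
  cases t with
  | none => exact hL
  | some a => exact hg a _

theorem Dominates.trans {K : ℝ} (hK : 1 ≤ K) {g : Fin r → α → ℝ} {L : ℝ}
    (hg : ∀ a i, 0 ≤ g a i) (hL : 0 ≤ L) {S : Finset α} {t t' t'' : Option (Fin r)}
    (h : Dominates K g L S t t') (h' : Dominates K g L S t' t'') : Dominates K g L S t t'' := by
  intro i hi hmem
  have h1 := h i hi hmem
  have h2 := h' i hi hmem
  have h3 := termSize_nonneg hg hL i t'
  nlinarith

/-- A finite set contains a sequence with many elements of the set between any two terms. -/
theorem exists_spread (S : Finset α) (n H : ℕ) (hS : n * (H + 1) ≤ S.card) :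
    ∃ e : Fin n → α, StrictMono e ∧ (∀ k, e k ∈ S) ∧
      ∀ k l, k < l → H ≤ (S.filter fun s => e k < s ∧ s < e l).card := by
  classical
  let f := S.orderEmbOfFin rfl
  have hlt : ∀ k : Fin n, (k : ℕ) * (H + 1) + H < S.card := by
    intro k
    have : ((k : ℕ) + 1) * (H + 1) ≤ n * (H + 1) := Nat.mul_le_mul_right _ k.2
    have h2 : ((k : ℕ) + 1) * (H + 1) = k * (H + 1) + H + 1 := by ring
    omega
  refine ⟨fun k => f ⟨k * (H + 1), by have := hlt k; omega⟩, ?_, ?_, ?_⟩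
  · intro k l hkl
    apply f.strictMono
    rw [Fin.mk_lt_mk]
    exact Nat.mul_lt_mul_of_pos_right hkl (by omega)
  · intro k
    exact Finset.orderEmbOfFin_mem _ _ _
  · intro k l hkl
    let h : Fin H → α := fun t => f ⟨k * (H + 1) + 1 + t, by have := hlt k; omega⟩
    have hinj : Function.Injective h := by
      intro t t' htt
      have := f.injective htt
      simp only [Fin.mk.injEq] at this
      exact Fin.ext (by omega)
    have hsub : Finset.univ.image h ⊆
        S.filter fun s => f ⟨k * (H + 1), by have := hlt k; omega⟩ < s ∧
          s < f ⟨l * (H + 1), by have := hlt l; omega⟩ := by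
      intro s hs
      obtain ⟨t, -, rfl⟩ := Finset.mem_image.1 hs
      refine Finset.mem_filter.2 ⟨Finset.orderEmbOfFin_mem _ _ _, f.strictMono ?_, f.strictMono ?_⟩
      · rw [Fin.mk_lt_mk]; omega
      · rw [Fin.mk_lt_mk]
        have h1 : ((k : ℕ) + 1) * (H + 1) ≤ l * (H + 1) := Nat.mul_le_mul_right _ hkl
        have h2 : ((k : ℕ) + 1) * (H + 1) = k * (H + 1) + H + 1 := by ring
        omega
    have h1 := Finset.card_le_card hsub
    rwa [Finset.card_image_of_injective _ hinj, Finset.card_univ, Fintype.card_fin] at h1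

/-- An increasing and a decreasing function, one of them lacunary, are far apart on one of the
two sides of any element. -/
theorem exists_separated {K : ℝ} {g h : α → ℝ} {S : Finset α} {H : ℕ} (hS : 3 * (H + 1) ≤ S.card)
    (hg : LacunaryUp 1 g S) (hh : LacunaryDown 1 h S)
    (hK : 0 ≤ K) (hlac : LacunaryUp K g S ∨ LacunaryDown K h S) :
    ∃ S' ⊆ S, H ≤ S'.card ∧
      ((∀ i ∈ S', ∀ k ∈ S', K * h k ≤ g i) ∨ (∀ i ∈ S', ∀ k ∈ S', K * g i ≤ h k)) := by
  classical
  obtain ⟨e, -, heS, hcard⟩ := exists_spread S 3 H hS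
  -- Compare at the middle point: whichever function is larger there stays larger on the side where
  -- it grows and the other shrinks, and the lacunary one supplies the factor `K`.
  rcases le_total (h (e 1)) (g (e 1)) with hle | hle
  · refine ⟨_, Finset.filter_subset _ _, hcard 1 2 (by decide), Or.inl ?_⟩
    intro i hi k hk
    simp only [Finset.mem_filter] at hi hk
    have h1 := hg _ (heS 1) i hi.1 hi.2.1
    have h2 := hh _ (heS 1) k hk.1 hk.2.1
    rcases hlac with hl | hl
    · have h3 := hl _ (heS 1) i hi.1 hi.2.1
      nlinarith
    · have h3 := hl _ (heS 1) k hk.1 hk.2.1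
      nlinarith
  · refine ⟨_, Finset.filter_subset _ _, hcard 0 1 (by decide), Or.inr ?_⟩
    intro i hi k hk
    simp only [Finset.mem_filter] at hi hk
    have h1 := hg i hi.1 _ (heS 1) hi.2.2
    have h2 := hh k hk.1 _ (heS 1) hk.2.2
    rcases hlac with hl | hl
    · have h3 := hl i hi.1 _ (heS 1) hi.2.2
      nlinarith
    · have h3 := hl k hk.1 _ (heS 1) hk.2.2
      nlinarith

theorem LacunaryUp.weaken {K K' : ℝ} (h : K' ≤ K) {g : α → ℝ} (hg : ∀ i, 0 ≤ g i)
    {S : Finset α} (hu : LacunaryUp K g S) : LacunaryUp K' g S :=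
  fun i hi k hk hik => (mul_le_mul_of_nonneg_right h (hg i)).trans (hu i hi k hk hik)

theorem LacunaryDown.weaken {K K' : ℝ} (h : K' ≤ K) {g : α → ℝ} (hg : ∀ i, 0 ≤ g i)
    {S : Finset α} (hu : LacunaryDown K g S) : LacunaryDown K' g S :=
  fun i hi k hk hik => (mul_le_mul_of_nonneg_right h (hg k)).trans (hu i hi k hk hik)

/-- Of two increasing terms, the later one dominates on a spread-out set, unless it is dominated
on a large set. -/
theorem dominates_of_lacunaryUp {K : ℝ} (hK : 1 ≤ K) {g : Fin r → α → ℝ} {L : ℝ}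
    (hg : ∀ a i, 0 ≤ g a i) {S T : Finset α} {H : ℕ} {a b : Fin r} (hab : a < b)
    (ha : LacunaryUp (K ^ 2) (g a) S) (hb : LacunaryUp (K ^ 2) (g b) S) (hT : T ⊆ S)
    (hspread : ∀ i ∈ T, ∀ k ∈ T, i < k → H ≤ (S.filter fun s => i < s ∧ s < k).card)
    (hno : ∀ S' ⊆ S, H ≤ S'.card → ¬ Dominates K g L S' (some a) (some b)) :
    Dominates K g L T (some b) (some a) := by
  intro i hi hmem
  -- Non-domination between `i a` and `i b` yields a tuple `z` with `g a (z a) < K * g b (z b)`.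
  -- This loses one factor `K`, which is why the ratio of lacunarity is `K ^ 2`.
  have h1 := hno _ (Finset.filter_subset _ _) (hspread _ (hmem a) _ (hmem b) (hi hab))
  simp only [Dominates, not_forall, not_le] at h1
  obtain ⟨z, -, hz, hlt⟩ := h1
  simp only [termSize, Finset.mem_filter] at hlt hz ⊢
  have h2 := (ha.weaken (one_le_pow₀ hK) (hg a)) _ (hT (hmem a)) _ (hz a).1 (hz a).2.1
  have h3 := hb _ (hz b).1 _ (hT (hmem b)) (hz b).2.2
  have h4 := hg a (z a)
  nlinarith

/-- Of two decreasing terms, the earlier one dominates on a spread-out set, unless it is dominated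
on a large set. -/
theorem dominates_of_lacunaryDown {K : ℝ} (hK : 1 ≤ K) {g : Fin r → α → ℝ} {L : ℝ}
    (hg : ∀ a i, 0 ≤ g a i) {S T : Finset α} {H : ℕ} {a b : Fin r} (hab : b < a)
    (ha : LacunaryDown (K ^ 2) (g a) S) (hb : LacunaryDown (K ^ 2) (g b) S) (hT : T ⊆ S)
    (hspread : ∀ i ∈ T, ∀ k ∈ T, i < k → H ≤ (S.filter fun s => i < s ∧ s < k).card)
    (hno : ∀ S' ⊆ S, H ≤ S'.card → ¬ Dominates K g L S' (some a) (some b)) :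
    Dominates K g L T (some b) (some a) := by
  intro i hi hmem
  have h1 := hno _ (Finset.filter_subset _ _) (hspread _ (hmem b) _ (hmem a) (hi hab))
  simp only [Dominates, not_forall, not_le] at h1
  obtain ⟨z, -, hz, hlt⟩ := h1
  simp only [termSize, Finset.mem_filter] at hlt hz ⊢
  have h2 := (ha.weaken (one_le_pow₀ hK) (hg a)) _ (hz a).1 _ (hT (hmem a)) (hz a).2.2
  have h3 := hb _ (hT (hmem b)) _ (hz b).1 (hz b).2.1
  have h4 := hg a (z a)
  nlinarith

/-- If no term in `C` is dominated by another one on a large subset of `S`, then one of them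
dominates all the others on a spread-out subset. -/
theorem exists_dominates_of_spread {K : ℝ} (hK : 1 ≤ K) {g : Fin r → α → ℝ} {L : ℝ}
    (hg : ∀ a i, 0 ≤ g a i) {S T : Finset α} {H : ℕ} (hS : 3 * (H + 1) ≤ S.card)
    (htype : ∀ a, LacunaryUp (K ^ 2) (g a) S ∨ LacunaryDown (K ^ 2) (g a) S) (hT : T ⊆ S)
    (hspread : ∀ i ∈ T, ∀ k ∈ T, i < k → H ≤ (S.filter fun s => i < s ∧ s < k).card)
    {C : Finset (Option (Fin r))} (hC : C.Nonempty)
    (hno : ∀ t ∈ C, ∀ t' ∈ C, t ≠ t' → ∀ S' ⊆ S, H ≤ S'.card → ¬ Dominates K g L S' t t') :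
    ∃ b ∈ C, ∀ t ∈ C, t ≠ b → Dominates K g L T b t := by
  classical
  have hK2 : K ≤ K ^ 2 := by nlinarith
  have h1K2 : (1 : ℝ) ≤ K ^ 2 := one_le_pow₀ hK
  -- A constant is both increasing and decreasing in the weak sense, so it can be separated from any
  -- lacunary term; hence no other candidate can be present.
  by_cases hnone : none ∈ C
  · refine ⟨none, hnone, fun t ht htn => ?_⟩
    exfalso
    obtain ⟨a, rfl⟩ := Option.ne_none_iff_exists'.1 htn
    rcases htype a with ha | ha
    · obtain ⟨S', hS', hc, h | h⟩ := exists_separated (h := fun _ => L) hS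
        (ha.weaken h1K2 (hg a)) (fun i _ k _ _ => by simp) (by linarith)
        (Or.inl (ha.weaken hK2 (hg a)))
      · exact hno _ ht _ hnone htn S' hS' hc fun i _ hm => h _ (hm a) _ (hm a)
      · exact hno _ hnone _ ht htn.symm S' hS' hc fun i _ hm => h _ (hm a) _ (hm a)
    · obtain ⟨S', hS', hc, h | h⟩ := exists_separated (g := fun _ => L) hS
        (fun i _ k _ _ => by simp) (ha.weaken h1K2 (hg a)) (by linarith)
        (Or.inr (ha.weaken hK2 (hg a)))
      · exact hno _ hnone _ ht htn.symm S' hS' hc fun i _ hm => h _ (hm a) _ (hm a)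
      · exact hno _ ht _ hnone htn S' hS' hc fun i _ hm => h _ (hm a) _ (hm a)
  set D := Finset.univ.filter (fun a : Fin r => some a ∈ C) with hD
  have hDne : D.Nonempty := by
    obtain ⟨t, ht⟩ := hC
    cases t with
    | none => exact absurd ht hnone
    | some a => exact ⟨a, by simpa [hD] using ht⟩
  have hmemD : ∀ a, a ∈ D ↔ some a ∈ C := fun a => by simp [hD]
  by_cases hup : ∀ a ∈ D, LacunaryUp (K ^ 2) (g a) S
  · refine ⟨some (D.max' hDne), (hmemD _).1 (D.max'_mem _), fun t ht htb => ?_⟩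
    cases t with
    | none => exact absurd ht hnone
    | some a =>
      have ha := (hmemD a).2 ht
      have hlt : a < D.max' hDne := lt_of_le_of_ne (D.le_max' a ha) fun h => htb (by rw [← h])
      exact dominates_of_lacunaryUp hK hg hlt (hup a ha) (hup _ (D.max'_mem _)) hT hspread
        (hno _ ht _ ((hmemD _).1 (D.max'_mem _)) htb)
  by_cases hdown : ∀ a ∈ D, LacunaryDown (K ^ 2) (g a) S
  · refine ⟨some (D.min' hDne), (hmemD _).1 (D.min'_mem _), fun t ht htb => ?_⟩
    cases t with
    | none => exact absurd ht hnone
    | some a =>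
      have ha := (hmemD a).2 ht
      have hlt : D.min' hDne < a := lt_of_le_of_ne (D.min'_le a ha) fun h => htb (by rw [h])
      exact dominates_of_lacunaryDown hK hg hlt (hdown a ha) (hdown _ (D.min'_mem _)) hT hspread
        (hno _ ht _ ((hmemD _).1 (D.min'_mem _)) htb)
  -- An increasing and a decreasing candidate cannot coexist: separation would make one dominate the
  -- other on a large set.
  exfalso
  push Not at hup hdown
  obtain ⟨b, hbD, hb⟩ := hup
  obtain ⟨a, haD, ha⟩ := hdown
  have ha' := (htype a).resolve_right ha
  have hb' := (htype b).resolve_left hb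
  have hab : (some a : Option (Fin r)) ≠ some b := fun h => hb (Option.some.inj h ▸ ha')
  obtain ⟨S', hS', hc, h | h⟩ := exists_separated hS (ha'.weaken h1K2 (hg a))
    (hb'.weaken h1K2 (hg b)) (by linarith : 0 ≤ K) (Or.inl (ha'.weaken hK2 (hg a)))
  · exact hno _ ((hmemD _).1 haD) _ ((hmemD _).1 hbD) hab S' hS' hc
      fun i _ hm => h _ (hm a) _ (hm b)
  · exact hno _ ((hmemD _).1 hbD) _ ((hmemD _).1 haD) hab.symm S' hS' hc
      fun i _ hm => h _ (hm a) _ (hm b)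

/-- Finitely many families of lacunary terms have dominating terms on a common subset of polynomial
size. The set `C j` holds the terms of the family `j` that are not known to be dominated. -/
theorem exists_subset_forall_dominates {J : Type*} [Fintype J] {K : ℝ} (hK : 1 ≤ K)
    {g : J → Fin r → α → ℝ} {L : J → ℝ} (hg : ∀ j a i, 0 ≤ g j a i) (hL : ∀ j, 0 ≤ L j)
    {n : ℕ} (hn : 1 ≤ n) (u : ℕ) (C : J → Finset (Option (Fin r))) (hC : ∀ j, (C j).Nonempty)
    (hCu : ∑ j, ((C j).card - 1) ≤ u) (S : Finset α)
    (htype : ∀ j a, LacunaryUp (K ^ 2) (g j a) S ∨ LacunaryDown (K ^ 2) (g j a) S)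
    (hcov : ∀ j, ∀ t, t ∉ C j → ∃ t' ∈ C j, Dominates K (g j) (L j) S t' t)
    (hS : (6 * n) ^ u * n ≤ S.card) :
    ∃ T ⊆ S, n ≤ T.card ∧ ∀ j, ∃ t, ∀ t', t' ≠ t → Dominates K (g j) (L j) T t t' := by
  classical
  induction u generalizing C S with
  | zero =>
    refine ⟨S, subset_rfl, by simpa using hS, fun j => ?_⟩
    have h0 : (C j).card - 1 = 0 := by
      have := Finset.single_le_sum (f := fun j => (C j).card - 1) (fun _ _ => Nat.zero_le _)
        (Finset.mem_univ j)
      omega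
    have h1 := (hC j).card_pos
    obtain ⟨t, ht⟩ := Finset.card_eq_one.1 (by omega : (C j).card = 1)
    refine ⟨t, fun t' ht' => ?_⟩
    obtain ⟨s, hs, hd⟩ := hcov j t' (by simp [ht, ht'])
    rw [ht, Finset.mem_singleton] at hs
    exact hs ▸ hd
  | succ u ih =>
    set H := (6 * n) ^ u * n with hH
    have hH1 : 1 ≤ H := Nat.succ_le_of_lt (by positivity)
    -- The factor `6 * n` covers both later needs, `3 * (H + 1)` and `n * (H + 1)`, as `H` and `n`
    -- are at least 1.
    have hSH : 6 * n * H ≤ S.card := by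
      calc 6 * n * H = (6 * n) ^ (u + 1) * n := by rw [hH]; ring
        _ ≤ _ := hS
    -- A candidate dominated on a large set is discarded, which lowers the potential; transitivity
    -- keeps all discarded terms dominated by surviving candidates.
    by_cases hex : ∃ j, ∃ t ∈ C j, ∃ t' ∈ C j, t ≠ t' ∧ ∃ S' ⊆ S, H ≤ S'.card ∧
        Dominates K (g j) (L j) S' t t'
    · obtain ⟨j, t, ht, t', ht', htt, S', hS', hc, hdom⟩ := hex
      have hne : ∀ k, (Function.update C j ((C j).erase t') k).Nonempty := by
        intro k
        by_cases hk : k = j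
        · subst hk
          rw [Function.update_self]
          exact ⟨t, Finset.mem_erase.2 ⟨htt, ht⟩⟩
        · rw [Function.update_of_ne hk]; exact hC k
      have hsum : ∑ k, ((Function.update C j ((C j).erase t') k).card - 1) ≤ u := by
        have h1 : ∑ k, ((Function.update C j ((C j).erase t') k).card - 1) <
            ∑ k, ((C k).card - 1) := by
          apply Finset.sum_lt_sum
          · intro k _
            by_cases hk : k = j
            · subst hk
              rw [Function.update_self]
              exact Nat.sub_le_sub_right (Finset.card_le_card (Finset.erase_subset _ _)) 1
            · rw [Function.update_of_ne hk]
          · refine ⟨j, Finset.mem_univ _, ?_⟩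
            rw [Function.update_self, Finset.card_erase_of_mem ht']
            have : 1 < (C j).card := Finset.one_lt_card.2 ⟨t, ht, t', ht', htt⟩
            omega
        omega
      have hcov' : ∀ k, ∀ s, s ∉ Function.update C j ((C j).erase t') k →
          ∃ s' ∈ Function.update C j ((C j).erase t') k, Dominates K (g k) (L k) S' s' s := by
        intro k s hs
        by_cases hk : k = j
        · subst hk
          rw [Function.update_self] at hs ⊢
          by_cases hst : s = t'
          · exact ⟨t, Finset.mem_erase.2 ⟨htt, ht⟩, hst ▸ hdom⟩
          · obtain ⟨s', hs', hd⟩ := hcov k s fun h => hs (Finset.mem_erase.2 ⟨hst, h⟩)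
            by_cases hst' : s' = t'
            · subst hst'
              exact ⟨t, Finset.mem_erase.2 ⟨htt, ht⟩,
                hdom.trans hK (hg k) (hL k) (hd.mono hS')⟩
            · exact ⟨s', Finset.mem_erase.2 ⟨hst', hs'⟩, hd.mono hS'⟩
        · rw [Function.update_of_ne hk] at hs ⊢
          obtain ⟨s', hs', hd⟩ := hcov k s hs
          exact ⟨s', hs', hd.mono hS'⟩
      obtain ⟨T, hT, hTn, hTd⟩ := ih (Function.update C j ((C j).erase t')) hne hsum S'
        (fun j a => (htype j a).imp (fun h => h.mono hS') (fun h => h.mono hS')) hcov' hc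
      exact ⟨T, hT.trans hS', hTn, hTd⟩
    · push Not at hex
      obtain ⟨e, hemono, heS, hcard⟩ := exists_spread S n H (by nlinarith)
      have hTS : Finset.univ.image e ⊆ S := by
        intro s hs
        obtain ⟨k, -, rfl⟩ := Finset.mem_image.1 hs
        exact heS k
      refine ⟨Finset.univ.image e, hTS, ?_, fun j => ?_⟩
      · rw [Finset.card_image_of_injective _ hemono.injective]; simp
      · obtain ⟨b, hb, hbd⟩ := exists_dominates_of_spread hK (hg j) (L := L j) (H := H) (by nlinarith)
          (htype j) hTS (by
            intro i hi k hk hik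
            obtain ⟨i, -, rfl⟩ := Finset.mem_image.1 hi
            obtain ⟨k, -, rfl⟩ := Finset.mem_image.1 hk
            exact hcard i k (hemono.lt_iff_lt.1 hik)) (hC j) (hex j)
        refine ⟨b, fun t htb => ?_⟩
        by_cases ht : t ∈ C j
        · exact hbd t ht htb
        · obtain ⟨s, hs, hd⟩ := hcov j t ht
          by_cases hsb : s = b
          · exact hsb ▸ hd.mono hTS
          · exact (hbd s hs hsb).trans hK (hg j) (hL j) (hd.mono hTS)

/-- The sign of a sum is that of a dominating term. -/
theorem sign_sum_eq_of_dominant {τ : Type*} [Fintype τ] (v : τ → ℝ) (t : τ)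
    (h : ∀ s, s ≠ t → (Fintype.card τ : ℝ) * |v s| ≤ |v t|) :
    SignType.sign (∑ s, v s) = SignType.sign (v t) := by
  classical
  set c := (Fintype.card τ : ℝ) with hc
  have hpos : 0 < Fintype.card τ := Fintype.card_pos_iff.2 ⟨t⟩
  have hc0 : 0 < c := Nat.cast_pos.2 hpos
  have hsum : ∑ s, v s = v t + ∑ s ∈ Finset.univ.erase t, v s :=
    (Finset.add_sum_erase _ _ (Finset.mem_univ t)).symm
  set R := ∑ s ∈ Finset.univ.erase t, v s
  -- Each of the other `c - 1` terms is at most `|v t| / c`, so together they stay below `|v t|`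
  -- unless it vanishes.
  have hR : c * |R| ≤ (c - 1) * |v t| := by
    calc c * |R| ≤ c * ∑ s ∈ Finset.univ.erase t, |v s| := by
          gcongr; exact Finset.abs_sum_le_sum_abs _ _
      _ = ∑ s ∈ Finset.univ.erase t, c * |v s| := Finset.mul_sum _ _ _
      _ ≤ ∑ s ∈ Finset.univ.erase t, |v t| :=
          Finset.sum_le_sum fun s hs => h s (Finset.ne_of_mem_erase hs)
      _ = (c - 1) * |v t| := by
          rw [Finset.sum_const, Finset.card_erase_of_mem (Finset.mem_univ t), nsmul_eq_mul,
            Finset.card_univ, Nat.cast_sub hpos, Nat.cast_one]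
  rw [hsum]
  rcases lt_trichotomy (v t) 0 with h0 | h0 | h0
  · rw [sign_neg h0]
    rw [abs_of_neg h0] at hR
    refine sign_neg ?_
    have := le_abs_self R
    nlinarith
  · have : R = 0 := by
      rw [h0, abs_zero, mul_zero] at hR
      exact abs_nonpos_iff.1 (nonpos_of_mul_nonpos_right hR hc0)
    rw [h0, this, add_zero]
  · rw [sign_pos h0]
    rw [abs_of_pos h0] at hR
    refine sign_pos ?_
    have := neg_abs_le R
    nlinarith

end Domination

/-! ### Constant signs for finitely many forms -/

/-- The constant in the exponent of the semi-linear Ramsey bound for `m` forms in `r` points. -/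
def semilinearConst (p q : ℕ) : ℕ :=
  resolveConst p q q * 18 ^ (q * (q + 1))

/-- Finitely many sums of functions of the single entries of an increasing tuple have constant
signs on a common subset of polylogarithmic size. -/
theorem exists_subset_sign_eq {α : Type*} [LinearOrder α] {r m p : ℕ} (hr : 1 ≤ r) (hm : 1 ≤ m)
    (hp : ((r : ℝ) + 1) ^ 2 ≤ (1 + 1 / ((r : ℝ) + 1) ^ 2) ^ p)
    (x : Fin m → Fin r → α → ℝ) (b : Fin m → ℝ) {n : ℕ} (hn : 1 ≤ n) (W : Finset α)
    (hW : 2 ^ (semilinearConst p (m * r) * n ^ (4 * r ^ 2 * m ^ 2)) ≤ W.card) :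
    ∃ S ⊆ W, n ≤ S.card ∧ ∀ j, ∀ i i' : Fin r → α, StrictMono i → StrictMono i' →
      (∀ a, i a ∈ S) → (∀ a, i' a ∈ S) →
      SignType.sign (b j + ∑ a, x j a (i a)) = SignType.sign (b j + ∑ a, x j a (i' a)) := by
  classical
  set q := m * r with hq
  have hq1 : 1 ≤ q := Nat.mul_pos hm hr
  set K : ℝ := (r : ℝ) + 1 with hK
  have hK1 : 1 ≤ K := by simp [hK]
  set n₂ := (6 * n) ^ q * n with hn₂
  set n₁ := 3 ^ q * n₂ with hn₁
  have hn₁pos : 1 ≤ n₁ := Nat.succ_le_of_lt (by positivity)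
  have hcard : Fintype.card (Fin m × Fin r) = q := by simp [hq]
  -- The sizes are chosen backwards: `n₂` points suffice for domination with potential `q`, and `3 ^
  -- q` pays for the sign patterns.
  have hsize : 2 ^ (resolveConst p q q * n₁ ^ (q + 1)) ≤ W.card := by
    refine le_trans (Nat.pow_le_pow_right (by norm_num) ?_) hW
    have h1 : n₁ = 18 ^ q * n ^ (q + 1) := by
      rw [hn₁, hn₂, mul_pow, pow_succ n q, show (18 : ℕ) = 3 * 6 by norm_num, mul_pow]; ring
    have h2 : (q + 1) * (q + 1) ≤ 4 * r ^ 2 * m ^ 2 := by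
      calc (q + 1) * (q + 1) ≤ (2 * q) * (2 * q) := by gcongr <;> omega
        _ = 4 * r ^ 2 * m ^ 2 := by rw [hq]; ring
    calc resolveConst p q q * n₁ ^ (q + 1)
        = resolveConst p q q * 18 ^ (q * (q + 1)) * n ^ ((q + 1) * (q + 1)) := by
          rw [h1, mul_pow, ← pow_mul, ← pow_mul, ← mul_assoc]
      _ ≤ _ := Nat.mul_le_mul_left _ (Nat.pow_le_pow_right hn h2)
  obtain ⟨S₁, hS₁, hS₁c, hres⟩ := exists_forall_resolved (one_le_pow₀ hK1) hp
    (fun z : Fin m × Fin r => x z.1 z.2) hn₁pos q Finset.univ (by rw [Finset.card_univ, hcard]) W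
    (by rw [hcard]; exact hsize)
  choose c hc using fun z : Fin m × Fin r => hres z (Finset.mem_univ z)
  -- Domination fixes which term decides the sign, but not the sign of that term; hence this
  -- pigeonhole.
  obtain ⟨σ, -, hσ⟩ := Finset.exists_le_card_fiber_of_mul_le_card_of_maps_to
    (s := S₁) (t := (Finset.univ : Finset (Fin m × Fin r → SignType)))
    (f := fun w z => SignType.sign (x z.1 z.2 w - c z)) (n := n₂)
    (fun _ _ => Finset.mem_univ _) Finset.univ_nonempty (by
      rw [Finset.card_univ, Fintype.card_fun, hcard]; exact hS₁c)
  set S₂ := S₁.filter fun w => (fun z => SignType.sign (x z.1 z.2 w - c z)) = σ with hS₂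
  have hS₂S₁ : S₂ ⊆ S₁ := Finset.filter_subset _ _
  have hsign : ∀ w ∈ S₂, ∀ j a, SignType.sign (x j a w - c (j, a)) = σ (j, a) :=
    fun w hw j a => congrFun (Finset.mem_filter.1 hw).2 (j, a)
  obtain ⟨S, hS, hSn, hdom⟩ := exists_subset_forall_dominates hK1
    (g := fun j a w => |x j a w - c (j, a)|) (L := fun j => |b j + ∑ a, c (j, a)|)
    (fun _ _ _ => abs_nonneg _) (fun _ => abs_nonneg _) hn q
    (fun _ => Finset.univ) (fun _ => Finset.univ_nonempty)
    (by simp [hq]) S₂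
    (fun j a => (hc (j, a)).imp (fun h => h.mono hS₂S₁) (fun h => h.mono hS₂S₁))
    (fun j t ht => absurd (Finset.mem_univ t) ht) hσ
  refine ⟨S, hS.trans (hS₂S₁.trans hS₁), hSn, fun j i i' hi hi' hmem hmem' => ?_⟩
  obtain ⟨t, ht⟩ := hdom j
  let v : (Fin r → α) → Option (Fin r) → ℝ := fun i s =>
    s.elim (b j + ∑ a, c (j, a)) fun a => x j a (i a) - c (j, a)
  have habs : ∀ i s, termSize (fun a w => |x j a w - c (j, a)|) (|b j + ∑ a, c (j, a)|) i s =
      |v i s| := by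
    intro i s
    cases s <;> rfl
  have hsum : ∀ i, b j + ∑ a, x j a (i a) = ∑ s, v i s := by
    intro i
    simp only [v, Fintype.sum_option, Option.elim, Finset.sum_sub_distrib]
    ring
  have hmain : ∀ i, StrictMono i → (∀ a, i a ∈ S) →
      SignType.sign (b j + ∑ a, x j a (i a)) = SignType.sign (v i t) := by
    intro i hi hmem
    rw [hsum]
    refine sign_sum_eq_of_dominant _ _ fun s hs => ?_
    have h1 := ht s hs i hi hmem
    rw [habs, habs] at h1
    simpa [hK] using h1
  rw [hmain i hi hmem, hmain i' hi' hmem']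
  cases t with
  | none => rfl
  | some a => exact (hsign _ (hS (hmem a)) j a).trans (hsign _ (hS (hmem' a)) j a).symm

/-! ### Affine polynomials and hypergraphs -/

/-- A polynomial of total degree at most one is an affine function. -/
theorem MvPolynomial.eval_eq_of_totalDegree_le_one {σ R : Type*} [Fintype σ] [CommSemiring R]
    (f : MvPolynomial σ R) (hf : f.totalDegree ≤ 1) (y : σ → R) :
    MvPolynomial.eval y f =
      f.coeff 0 + ∑ v, f.coeff (Finsupp.single v 1) * y v := by
  classical
  have hsub : f.support ⊆ insert 0 (Finset.univ.image fun v => Finsupp.single v 1) := by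
    intro s hs
    have h1 := (MvPolynomial.le_totalDegree hs).trans hf
    rw [Finsupp.sum_fintype _ _ (fun _ => rfl)] at h1
    by_cases h0 : s = 0
    · exact Finset.mem_insert.2 (Or.inl h0)
    · obtain ⟨v, hv⟩ := Finsupp.ne_iff.1 h0
      refine Finset.mem_insert_of_mem (Finset.mem_image.2 ⟨v, Finset.mem_univ _, ?_⟩)
      rw [← Finset.add_sum_erase _ _ (Finset.mem_univ v)] at h1
      simp only [Finsupp.coe_zero, Pi.zero_apply] at hv
      have h2 : ∑ w ∈ Finset.univ.erase v, s w = 0 := by omega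
      ext w
      by_cases hw : w = v
      · subst hw; simp only [Finsupp.single_eq_same]; omega
      · rw [Finsupp.single_eq_of_ne hw]
        exact (Finset.sum_eq_zero_iff.1 h2 w (Finset.mem_erase.2 ⟨hw, Finset.mem_univ _⟩)).symm
  rw [MvPolynomial.eval_eq', Finset.sum_subset hsub (fun s _ hs => by
    rw [MvPolynomial.notMem_support_iff.1 hs, zero_mul]), Finset.sum_insert (by simp),
    Finset.sum_image (fun v _ w _ h => by simpa using Finsupp.single_left_injective one_ne_zero h)]
  congr 1
  · simp
  · refine Finset.sum_congr rfl fun v _ => ?_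
    rw [Finset.prod_eq_single v (fun w _ hw => by rw [Finsupp.single_eq_of_ne hw, pow_zero])
      (by simp)]
    simp

namespace Hypergraph

/-- A semi-linear hypergraph has a clique or an independent set of polylogarithmic size. -/
theorem IsSemilinear.exists_isClique_or_isIndependent {α : Type*} {H : Hypergraph α}
    {r d m p : ℕ} (hr : 1 ≤ r) (hm : 1 ≤ m)
    (hp : ((r : ℝ) + 1) ^ 2 ≤ (1 + 1 / ((r : ℝ) + 1) ^ 2) ^ p)
    (hH : H.IsSemilinear r d m) {n N : ℕ} (hn : 1 ≤ n) (hN : V(H).encard = N)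
    (hW : 2 ^ (semilinearConst p (m * r) * n ^ (4 * r ^ 2 * m ^ 2)) ≤ N) :
    ∃ S : Set α, (H.IsClique r S ∨ H.IsIndependent r S) ∧ S.encard = n := by
  classical
  obtain ⟨-, N', v, pt, f, Φ, hv, hrange, hdeg, hE⟩ := hH
  have hNN : N' = N := by
    rw [← hrange, ← Set.image_univ, hv.encard_image, Set.encard_univ] at hN
    simpa using hN
  subst hNN
  let x : Fin m → Fin r → Fin N' → ℝ := fun j a w =>
    ∑ k, (f j).coeff (Finsupp.single (a, k) 1) * pt w k
  have heval : ∀ j (i : Fin r → Fin N'),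
      MvPolynomial.eval (fun z : Fin r × Fin d => pt (i z.1) z.2) (f j) =
        (f j).coeff 0 + ∑ a, x j a (i a) := by
    intro j i
    rw [MvPolynomial.eval_eq_of_totalDegree_le_one _ (hdeg j), Fintype.sum_prod_type]
  obtain ⟨S, -, hSn, hS⟩ := exists_subset_sign_eq hr hm hp x (fun j => (f j).coeff 0) hn
    (Finset.univ : Finset (Fin N')) (by simpa using hW)
  have hconst : ∀ i i' : Fin r → Fin N', StrictMono i → StrictMono i' → (∀ a, i a ∈ S) →
      (∀ a, i' a ∈ S) → (Set.range (v ∘ i) ∈ E(H) ↔ Set.range (v ∘ i') ∈ E(H)) := by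
    intro i i' hi hi' hm hm'
    rw [hE i hi, hE i' hi']
    have : (fun j => SignType.sign (MvPolynomial.eval
        (fun z : Fin r × Fin d => pt (i z.1) z.2) (f j))) = fun j => SignType.sign
        (MvPolynomial.eval (fun z : Fin r × Fin d => pt (i' z.1) z.2) (f j)) := by
      funext j
      rw [heval, heval]
      exact hS j i i' hi hi' hm hm'
    rw [this]
  obtain ⟨T, hTS, hTn⟩ := Finset.exists_subset_card_eq hSn
  have htuple : ∀ e : Set α, e ⊆ v '' T → e.encard = r →
      ∃ i : Fin r → Fin N', StrictMono i ∧ (∀ a, i a ∈ S) ∧ Set.range (v ∘ i) = e := by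
    intro e he her
    obtain ⟨U, hUT, rfl⟩ := Set.subset_image_iff.1 he
    have hUf : U.Finite := U.toFinite
    rw [hv.encard_image] at her
    have hUc : hUf.toFinset.card = r := by
      rw [hUf.encard_eq_coe_toFinset_card] at her
      exact_mod_cast her
    refine ⟨hUf.toFinset.orderEmbOfFin hUc, OrderEmbedding.strictMono _, fun a => ?_, ?_⟩
    · have := Finset.orderEmbOfFin_mem hUf.toFinset hUc a
      exact hTS (hUT (hUf.mem_toFinset.1 this))
    · rw [Set.range_comp, Finset.range_orderEmbOfFin, hUf.coe_toFinset]
  have hTV : v '' T ⊆ V(H) := by rw [← hrange]; exact Set.image_subset_range _ _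
  refine ⟨v '' T, ?_, ?_⟩
  · by_cases hall : ∀ e : Set α, e ⊆ v '' T → e.encard = r → e ∈ E(H)
    · exact Or.inl ⟨hTV, hall⟩
    -- One missing `r`-subset rules out all the others, since membership is the same for all
    -- increasing tuples.
    · push Not at hall
      obtain ⟨e₀, he₀, hr₀, hn₀⟩ := hall
      obtain ⟨i₀, hi₀, hm₀, rfl⟩ := htuple e₀ he₀ hr₀
      refine Or.inr ⟨hTV, fun e he her hin => hn₀ ?_⟩
      obtain ⟨i, hi, hm, rfl⟩ := htuple e he her
      exact (hconst i i₀ hi hi₀ hm hm₀).1 hin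
  · rw [hv.encard_image, Set.encard_coe_eq_coe_finsetCard, hTn]

/-- A set of vertices with at most one `r`-element subset is a clique or an independent set. -/
theorem isClique_or_isIndependent_of_forall_eq {α : Type*} {H : Hypergraph α} {r : ℕ} {S : Set α}
    (hS : S ⊆ V(H))
    (h : ∀ e e' : Set α, e ⊆ S → e' ⊆ S → e.encard = r → e'.encard = r → e = e') :
    H.IsClique r S ∨ H.IsIndependent r S := by
  by_cases hex : ∃ e ⊆ S, e.encard = r ∧ e ∈ E(H)
  · obtain ⟨e, he, her, hE⟩ := hex
    exact Or.inl ⟨hS, fun e' he' her' => h e e' he he' her her' ▸ hE⟩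
  · push Not at hex
    exact Or.inr ⟨hS, hex⟩

theorem isClique_or_isIndependent_singleton {α : Type*} {H : Hypergraph α} {r : ℕ} (hr : 1 ≤ r)
    {a : α} (ha : a ∈ V(H)) : H.IsClique r {a} ∨ H.IsIndependent r {a} := by
  have hsing : ∀ e : Set α, e ⊆ {a} → e.encard = r → e = {a} := by
    intro e he her
    rcases Set.subset_singleton_iff_eq.1 he with rfl | h
    · rw [Set.encard_empty] at her
      have : r = 0 := by exact_mod_cast her.symm
      omega
    · exact h
  exact isClique_or_isIndependent_of_forall_eq (Set.singleton_subset_iff.2 ha)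
    fun e e' he he' her her' => (hsing e he her).trans (hsing e' he' her').symm

/-- Every hypergraph on at least three vertices has two vertices that form a clique or an
independent set. -/
theorem exists_isClique_or_isIndependent_pair {α : Type*} (H : Hypergraph α) {r : ℕ} (hr : 1 ≤ r)
    (h : 3 ≤ V(H).encard) :
    ∃ S : Set α, (H.IsClique r S ∨ H.IsIndependent r S) ∧ S.encard = 2 := by
  obtain ⟨T, hT, hTc⟩ := Set.exists_subset_encard_eq h
  obtain ⟨a, b, c, hab, hac, hbc, rfl⟩ := Set.encard_eq_three.1 hTc
  have ha : a ∈ V(H) := hT (by simp)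
  have hb : b ∈ V(H) := hT (by simp)
  have hc : c ∈ V(H) := hT (by simp)
  -- For `r = 1`, two of three vertices agree on being edges; for larger `r`, a pair has at most one
  -- `r`-subset.
  rcases eq_or_lt_of_le hr with rfl | hr2
  · have hpair : ∀ {u w : α}, u ∈ V(H) → w ∈ V(H) → ({u} ∈ E(H) ↔ {w} ∈ E(H)) →
        H.IsClique 1 {u, w} ∨ H.IsIndependent 1 {u, w} := by
      intro u w hu hw hiff
      have hsub : ({u, w} : Set α) ⊆ V(H) := Set.pair_subset hu hw
      have hsing : ∀ e : Set α, e ⊆ {u, w} → e.encard = (1 : ℕ) → (e ∈ E(H) ↔ {u} ∈ E(H)) := by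
        intro e he her
        obtain ⟨z, rfl⟩ := Set.encard_eq_one.1 (by simpa using her)
        rcases he (Set.mem_singleton z) with rfl | hz
        · exact Iff.rfl
        · rw [Set.mem_singleton_iff.1 hz, hiff]
      by_cases hE : {u} ∈ E(H)
      · exact Or.inl ⟨hsub, fun e he her => (hsing e he her).2 hE⟩
      · exact Or.inr ⟨hsub, fun e he her hin => hE ((hsing e he her).1 hin)⟩
    by_cases h1 : ({a} ∈ E(H) ↔ {b} ∈ E(H))
    · exact ⟨_, hpair ha hb h1, Set.encard_pair hab⟩
    by_cases h2 : ({a} ∈ E(H) ↔ {c} ∈ E(H))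
    · exact ⟨_, hpair ha hc h2, Set.encard_pair hac⟩
    · exact ⟨_, hpair hb hc (by tauto), Set.encard_pair hbc⟩
  · refine ⟨{a, b}, isClique_or_isIndependent_of_forall_eq (Set.pair_subset ha hb) ?_,
      Set.encard_pair hab⟩
    have hall : ∀ e : Set α, e ⊆ {a, b} → e.encard = r → e = {a, b} := by
      intro e he her
      refine (Set.Finite.subset (Set.toFinite _) he).eq_of_subset_of_encard_le he ?_
      rw [Set.encard_pair hab, her]
      exact_mod_cast hr2
    exact fun e e' he he' her her' => (hall e he her).trans (hall e' he' her').symm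

end Hypergraph

/-! ### Explicit bounds -/

/-- The exponent `δ = 1 / (c + 2 * E)` turns a bound of the shape `2 ^ (c * n ^ E)` into a lower
bound by a power of the logarithm. -/
theorem log_rpow_le_of_lt {c E n N : ℕ} (hc : 1 ≤ c) (hn : 2 ≤ n) (hN0 : 1 ≤ N)
    (hN : N < 2 ^ (c * (n + 1) ^ E)) :
    (Real.log N) ^ (1 / ((c + 2 * E : ℕ) : ℝ)) ≤ n := by
  have hlog : Real.log N ≤ ((n ^ (c + 2 * E) : ℕ) : ℝ) := by
    have h1 : Real.log N ≤ ((c * (n + 1) ^ E : ℕ) : ℝ) * Real.log 2 := by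
      rw [← Real.log_pow]
      exact Real.log_le_log (by exact_mod_cast hN0) (by exact_mod_cast hN.le)
    have h2 : Real.log 2 ≤ 1 := by linarith [Real.log_two_lt_d9]
    have h3 : c * (n + 1) ^ E ≤ n ^ (c + 2 * E) := by
      calc c * (n + 1) ^ E ≤ n ^ c * (n * n) ^ E := by
            gcongr
            · exact (Nat.lt_pow_self (by omega)).le
            · nlinarith
        _ = n ^ (c + 2 * E) := by rw [pow_add, pow_mul n 2 E, pow_two]
    calc Real.log N ≤ ((c * (n + 1) ^ E : ℕ) : ℝ) * Real.log 2 := h1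
      _ ≤ ((c * (n + 1) ^ E : ℕ) : ℝ) * 1 := by gcongr
      _ ≤ _ := by rw [mul_one]; exact_mod_cast h3
  have hlog0 : 0 ≤ Real.log N := Real.log_natCast_nonneg N
  calc (Real.log N) ^ (1 / ((c + 2 * E : ℕ) : ℝ))
      ≤ ((n ^ (c + 2 * E) : ℕ) : ℝ) ^ (1 / ((c + 2 * E : ℕ) : ℝ)) :=
        Real.rpow_le_rpow hlog0 hlog (by positivity)
    _ = n := by
        rw [Nat.cast_pow, one_div, Real.pow_rpow_inv_natCast (by positivity) (by omega)]

theorem theorem1p3 (r m : ℕ) (hr : 1 ≤ r) (hm : 1 ≤ m) :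
    (∃ c : ℝ, 0 < c ∧ ∀ d n : ℕ, 1 ≤ d → 1 ≤ n →
      (∃ N : ℕ, SemialgebraicRamseyProperty r d 1 m n n N) ∧
      (semialgebraicRamsey r d 1 m n n : ℝ) ≤
        (2 : ℝ) ^ (c * (n : ℝ) ^ (4 * r ^ 2 * m ^ 2))) ∧
    (∃ δ : ℝ, 0 < δ ∧ ∀ d N : ℕ, 1 ≤ d →
      ∀ (α : Type*) (H : Hypergraph α), H.IsSemilinear r d m → V(H).encard = N →
        ∃ S : Set α, (H.IsClique r S ∨ H.IsIndependent r S) ∧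
          (Real.log N) ^ δ ≤ (S.ncard : ℝ)) := by
  classical
  obtain ⟨p, hp⟩ := pow_unbounded_of_one_lt (((r : ℝ) + 1) ^ 2)
    (show (1 : ℝ) < 1 + 1 / ((r : ℝ) + 1) ^ 2 by simp; positivity)
  set E := 4 * r ^ 2 * m ^ 2 with hE
  have hE1 : 1 ≤ E := Nat.succ_le_of_lt (by positivity)
  set c := semilinearConst p (m * r) + 1 with hc
  have hexp : ∀ n N : ℕ, 2 ^ (c * n ^ E) ≤ N → 2 ^ (semilinearConst p (m * r) * n ^ E) ≤ N :=
    fun n N h => le_trans (Nat.pow_le_pow_right (by norm_num)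
      (Nat.mul_le_mul_right _ (by omega))) h
  refine ⟨⟨c, by exact_mod_cast Nat.succ_pos _, fun d n hd hn => ?_⟩,
    ⟨1 / ((c + 2 * E : ℕ) : ℝ), by positivity, fun d N hd α H hH hN => ?_⟩⟩
  · have hprop : SemialgebraicRamseyProperty r d 1 m n n (2 ^ (c * n ^ E)) := by
      intro α H hH hN
      obtain ⟨S, hS | hS, hSn⟩ := Hypergraph.IsSemilinear.exists_isClique_or_isIndependent hr hm
        hp.le hH hn hN (hexp n _ le_rfl)
      · exact Or.inl ⟨S, hS, hSn⟩
      · exact Or.inr ⟨S, hS, hSn⟩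
    refine ⟨⟨_, hprop⟩, ?_⟩
    have h1 : semialgebraicRamsey r d 1 m n n ≤ 2 ^ (c * n ^ E) := Nat.sInf_le hprop
    have h2 : (c : ℝ) * (n : ℝ) ^ E = ((c * n ^ E : ℕ) : ℝ) := by push_cast; ring
    rw [h2, Real.rpow_natCast]
    exact_mod_cast h1
  -- The passage to logarithms needs `2 ≤ n`. For `N ≤ 2` the logarithm is below 1, so at most one
  -- vertex is required; from 3 vertices on, a homogeneous pair always exists.
  · rcases Nat.lt_or_ge N 3 with hN3 | hN3
    · rcases Nat.lt_or_ge N 2 with hN2 | hN2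
      · refine ⟨∅, Hypergraph.isClique_or_isIndependent_of_forall_eq (Set.empty_subset _)
          fun e e' he he' _ _ => (Set.subset_empty_iff.1 he).trans
            (Set.subset_empty_iff.1 he').symm, ?_⟩
        have : Real.log N = 0 := by interval_cases N <;> simp
        rw [this, Real.zero_rpow (by positivity)]
        positivity
      · obtain ⟨a, ha⟩ : V(H).Nonempty := by
          rw [← Set.encard_ne_zero, hN]
          exact_mod_cast (by omega : N ≠ 0)
        refine ⟨{a}, Hypergraph.isClique_or_isIndependent_singleton hr ha, ?_⟩
        have hN' : N = 2 := by omega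
        rw [Set.ncard_singleton, Nat.cast_one, hN']
        exact Real.rpow_le_one (Real.log_natCast_nonneg 2)
          (by push_cast; linarith [Real.log_two_lt_d9]) (by positivity)
    · obtain ⟨n, hn2, hlt, S, hS, hSn⟩ : ∃ n, 2 ≤ n ∧ N < 2 ^ (c * (n + 1) ^ E) ∧
          ∃ S : Set α, (H.IsClique r S ∨ H.IsIndependent r S) ∧ S.encard = n := by
        by_cases h2 : 2 ^ (c * 2 ^ E) ≤ N
        -- Admissible `k` are at most `N`, so the bounded search below finds the true maximum.
        · have hle : ∀ k, 2 ^ (c * k ^ E) ≤ N → k ≤ N := by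
            intro k hk
            have h3 : k ≤ c * k ^ E :=
              (Nat.le_self_pow (by omega) k).trans (Nat.le_mul_of_pos_left _ (Nat.succ_pos _))
            exact (h3.trans Nat.lt_two_pow_self.le).trans hk
          set n := Nat.findGreatest (fun k => 2 ^ (c * k ^ E) ≤ N) N with hn
          have hn2 : 2 ≤ n := Nat.le_findGreatest (hle 2 h2) h2
          have hPn : 2 ^ (c * n ^ E) ≤ N :=
            Nat.findGreatest_spec (P := fun k => 2 ^ (c * k ^ E) ≤ N) (hle 2 h2) h2
          refine ⟨n, hn2, ?_, hH.exists_isClique_or_isIndependent hr hm hp.le (by omega) hN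
            (hexp n _ hPn)⟩
          by_contra hcon
          have h4 := not_lt.1 hcon
          have h5 : n + 1 ≤ n := Nat.le_findGreatest (hle _ h4) h4
          omega
        · refine ⟨2, le_rfl, (not_le.1 h2).trans_le (Nat.pow_le_pow_right (by norm_num)
            (Nat.mul_le_mul_left _ (Nat.pow_le_pow_left (by norm_num) E))), ?_⟩
          exact H.exists_isClique_or_isIndependent_pair hr (by rw [hN]; exact_mod_cast hN3)
      refine ⟨S, hS, ?_⟩
      have hncard : S.ncard = n := by rw [Set.ncard_def, hSn]; rfl
      rw [hncard]
      exact log_rpow_le_of_lt (Nat.succ_pos _) hn2 (by omega) hlt
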